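/- Let $\Omega\subset\mathbb C$ be a bounded finitely connected region (a non-empty bounded connected open set whose complement has finitely many connected components), let $z_0\in\Omega$, and let $m$ be the harmonic measure on $\partial\Omega$ for the point $z_0$; "almost every" $\zeta\in\partial\Omega$ refers to $m$. Let $K$ and $K'$ be complex Hilbert spaces with $\dim K=\dim K'=n<\infty$, and let $\varphi\in H^\infty(\Omega,L(K,K'))$, that is, $\varphi:\Omega\to L(K,K')$ is bounded and analytic. For $\zeta\in\partial\Omega$ write $\varphi(\zeta)$ for the nontangential limit of $\varphi$ at $\zeta$, that is, the limit of $\varphi(z)$ as $z\to\zeta$ within each of the regions $\{z\in\Omega : |z-\zeta|<(1+\alpha)\,\mathrm{dist}(z,\partial\Omega)\}$, $\alpha>0$ (with the convention $\varphi(\zeta)=0$ where $\varphi$ has no nontangential limit or $\zeta$ is not a limit point of any of these regions). Suppose that $\varphi$ is quasi-inner: there is a constant $c>0$ such that $$\|\varphi(\zeta)k\|\ \ge\ c\,\|k\|\qquad\text{for every } k\in K \text{ and almost every } \zeta\in\partial\Omega .$$ Then for almost every $\zeta\in\partial\Omega$ the function $\varphi$ tends nontangentially to $\varphi(\zeta)$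 at $\zeta$, and $\varphi(\zeta)$ is invertible in $L(K,K')$. -/

import Mathlib

open MeasureTheory Filter Topology

/-- A bounded finitely connected region of the plane: a bounded nonempty connected open set whose
complement has finitely many connected components. (For a bounded set the components of the
complement in `ℂ` correspond to those of the complement in the Riemann sphere.) -/
structure IsBoundedFinitelyConnectedRegion (Ω : Set ℂ) : Prop where
  isOpen : IsOpen Ω
  isConnected : IsConnected Ω
  isBounded : Bornology.IsBounded Ω
  finite_components : Finite (ConnectedComponents (Ωᶜ : Set ℂ))

/-- Continuous subharmonic functions on an open set, through the sub-mean value inequality. -/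
structure IsSubharmonicOn (u : ℂ → ℝ) (Ω : Set ℂ) : Prop where
  continuousOn : ContinuousOn u Ω
  le_circleAverage : ∀ (c : ℂ) (r : ℝ), 0 < r → Metric.closedBall c r ⊆ Ω →
    u c ≤ Real.circleAverage u c r

/-- The Perron family of boundary data `f`: subharmonic functions `u` on `Ω` with
`limsup_{z → ζ} u(z) ≤ f(ζ)` at every boundary point `ζ`. -/
def perronFamily (Ω : Set ℂ) (f : ℂ → ℝ) : Set (ℂ → ℝ) :=
  {u | IsSubharmonicOn u Ω ∧
    ∀ ζ ∈ frontier Ω, ∀ ε > 0, ∀ᶠ z in 𝓝[Ω] ζ, u z < f ζ + ε}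

/-- The Perron solution at `z₀` of the Dirichlet problem on `Ω` with boundary data `f`. -/
noncomputable def perronSolution (Ω : Set ℂ) (f : ℂ → ℝ) (z₀ : ℂ) : ℝ :=
  sSup ((fun u : ℂ → ℝ => u z₀) '' perronFamily Ω f)

/-- `m` is the harmonic measure of `Ω` for the point `z₀`: the (unique) Borel probability measure
carried by the boundary of `Ω` such that, for every continuous function `f` on the boundary, the
solution of the Dirichlet problem with boundary data `f` has the value `∫ f dm` at `z₀`. -/
structure IsHarmonicMeasure (Ω : Set ℂ) (z₀ : ℂ) (m : Measure ℂ) : Prop where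
  isProbabilityMeasure : IsProbabilityMeasure m
  compl_frontier : m (frontier Ω)ᶜ = 0
  perronSolution_eq : ∀ f : ℂ → ℝ, ContinuousOn f (frontier Ω) →
    perronSolution Ω f z₀ = ∫ ζ, f ζ ∂m

/-- The nontangential approach region at the boundary point `ζ` with aperture `α`. -/
def approachRegion (Ω : Set ℂ) (ζ : ℂ) (α : ℝ) : Set ℂ :=
  {z ∈ Ω | dist z ζ < (1 + α) * Metric.infDist z (frontier Ω)}

/-- Nontangential approach to the boundary point `ζ` from inside `Ω`: a function tends to a limit
along this filter iff it does so in the approach regions of all apertures. -/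
noncomputable def nontangential (Ω : Set ℂ) (ζ : ℂ) : Filter ℂ :=
  ⨆ α : {α : ℝ // 0 < α}, 𝓝[approachRegion Ω ζ α] ζ

section BoundaryValues

variable {E : Type*} [NormedAddCommGroup E]

/-- `φ` has the nontangential limit `T` at `ζ` (a point that can be approached nontangentially). -/
def HasNontangentialLimit (Ω : Set ℂ) (φ : ℂ → E) (ζ : ℂ) (T : E) : Prop :=
  (nontangential Ω ζ).NeBot ∧ Tendsto φ (nontangential Ω ζ) (𝓝 T)

open Classical in
/-- The boundary function `φ*` of `φ`: its nontangential limit at `ζ`, and `0` where there is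
none. -/
noncomputable def boundaryValue (Ω : Set ℂ) (φ : ℂ → E) (ζ : ℂ) : E :=
  if h : ∃ T, HasNontangentialLimit Ω φ ζ T then h.choose else 0

theorem HasNontangentialLimit.boundaryValue_eq {Ω : Set ℂ} {φ : ℂ → E} {ζ : ℂ} {T : E}
    (h : HasNontangentialLimit Ω φ ζ T) : boundaryValue Ω φ ζ = T := by
  have h' : ∃ T, HasNontangentialLimit Ω φ ζ T := ⟨T, h⟩
  have := h.1
  rw [boundaryValue, dif_pos h']
  exact tendsto_nhds_unique h'.choose_spec.2 h.2

end BoundaryValues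

section QuasiInner

variable {K K' : Type*} [NormedAddCommGroup K] [InnerProductSpace ℂ K]
  [NormedAddCommGroup K'] [InnerProductSpace ℂ K']

/-- Membership in `H^∞(Ω, L(K, K'))`: bounded analytic operator-valued functions on `Ω`. -/
structure MemHInfty (Ω : Set ℂ) (φ : ℂ → K →L[ℂ] K') : Prop where
  analyticOnNhd : AnalyticOnNhd ℂ φ Ω
  bounded : ∃ C : ℝ, ∀ z ∈ Ω, ‖φ z‖ ≤ C

/-- `φ` is quasi-inner (`m` being harmonic measure on the boundary of `Ω`): its boundary values
are bounded below by a common constant `c > 0`, almost everywhere. -/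
def IsQuasiInner (Ω : Set ℂ) (m : Measure ℂ) (φ : ℂ → K →L[ℂ] K') : Prop :=
  ∃ c : ℝ, 0 < c ∧ ∀ k : K, ∀ᵐ ζ ∂m, c * ‖k‖ ≤ ‖boundaryValue Ω φ ζ k‖

end QuasiInner

section BoundaryValues

variable {E : Type*} [NormedAddCommGroup E]

/-! No Fatou theorem is needed: the lower bound itself forces limits to exist. The null set in the
hypothesis depends on `k`; separability of `K` yields one null set for all `k`
(`ae_forall_le_norm_apply`). Off it `φ(ζ)` is injective, hence invertible by equality of dimensions.
If `K ≠ 0`, then `φ(ζ) ≠ 0`, so `φ(ζ)` is not the default value and must be a true limit. -/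

theorem HasNontangentialLimit.tendsto_boundaryValue {Ω : Set ℂ} {φ : ℂ → E} {ζ : ℂ} {T : E}
    (h : HasNontangentialLimit Ω φ ζ T) :
    Tendsto φ (nontangential Ω ζ) (𝓝 (boundaryValue Ω φ ζ)) :=
  h.boundaryValue_eq.symm ▸ h.2

/-- By the convention for the boundary function, a nonzero boundary value is a genuine
nontangential limit. -/
theorem exists_hasNontangentialLimit_of_boundaryValue_ne_zero {Ω : Set ℂ} {φ : ℂ → E} {ζ : ℂ}
    (h : boundaryValue Ω φ ζ ≠ 0) : ∃ T, HasNontangentialLimit Ω φ ζ T := by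
  by_contra hT
  exact h (by rw [boundaryValue, dif_neg hT])

end BoundaryValues

/-- In a family of operators on a separable space, lower bounds that hold almost everywhere for
each vector hold almost everywhere for all vectors simultaneously. -/
theorem ae_forall_le_norm_apply {X K K' : Type*} [MeasurableSpace X] {m : Measure X}
    [NormedAddCommGroup K] [NormedSpace ℂ K] [TopologicalSpace.SeparableSpace K]
    [NormedAddCommGroup K'] [NormedSpace ℂ K'] {A : X → K →L[ℂ] K'} {c : ℝ}
    (h : ∀ k : K, ∀ᵐ x ∂m, c * ‖k‖ ≤ ‖A x k‖) :
    ∀ᵐ x ∂m, ∀ k : K, c * ‖k‖ ≤ ‖A x k‖ := by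
  have hdense : ∀ᵐ x ∂m, ∀ i : ℕ, c * ‖TopologicalSpace.denseSeq K i‖ ≤
      ‖A x (TopologicalSpace.denseSeq K i)‖ := ae_all_iff.2 fun i => h _
  filter_upwards [hdense] with x hx k
  have hclosed : IsClosed {k : K | c * ‖k‖ ≤ ‖A x k‖} :=
    isClosed_le (by fun_prop) (by fun_prop)
  exact (TopologicalSpace.denseRange_denseSeq K).induction_on k hclosed hx

/-- An operator that is bounded below is invertible if its domain and codomain have the same
finite dimension. -/
theorem ContinuousLinearMap.isInvertible_of_le_norm_apply {K K' : Type*}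
    [NormedAddCommGroup K] [NormedSpace ℂ K] [FiniteDimensional ℂ K]
    [NormedAddCommGroup K'] [NormedSpace ℂ K'] [FiniteDimensional ℂ K']
    (hdim : Module.finrank ℂ K = Module.finrank ℂ K') {T : K →L[ℂ] K'} {c : ℝ} (hc : 0 < c)
    (h : ∀ k : K, c * ‖k‖ ≤ ‖T k‖) : T.IsInvertible := by
  have hinj : Function.Injective (T : K →ₗ[ℂ] K') := by
    refine (injective_iff_map_eq_zero _).2 fun k hk => ?_
    have hTk : T k = 0 := hk
    have hle := h k
    rw [hTk, norm_zero] at hle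
    exact norm_le_zero_iff.1 (nonpos_of_mul_nonpos_right hle hc)
  refine ⟨(LinearEquiv.ofInjectiveOfFinrankEq (T : K →ₗ[ℂ] K') hinj hdim).toContinuousLinearEquiv,
    ?_⟩
  ext k
  rfl

theorem proposition3p2
    {K K' : Type*} [NormedAddCommGroup K] [InnerProductSpace ℂ K] [FiniteDimensional ℂ K]
    [NormedAddCommGroup K'] [InnerProductSpace ℂ K'] [FiniteDimensional ℂ K']
    (n : ℕ) (hK : Module.finrank ℂ K = n) (hK' : Module.finrank ℂ K' = n)
    (Ω : Set ℂ) (hΩ : IsBoundedFinitelyConnectedRegion Ω)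
    (z₀ : ℂ) (hz₀ : z₀ ∈ Ω) (m : Measure ℂ) (hm : IsHarmonicMeasure Ω z₀ m)
    (φ : ℂ → K →L[ℂ] K') (hφ : MemHInfty Ω φ) (hq : IsQuasiInner Ω m φ) :
    ∀ᵐ ζ ∂m, Tendsto φ (nontangential Ω ζ) (𝓝 (boundaryValue Ω φ ζ)) ∧
      (boundaryValue Ω φ ζ).IsInvertible := by
  obtain ⟨c, hc, hbound⟩ := hq
  -- Properness supplies the separability of `K` used to merge the null sets.
  have : ProperSpace K := FiniteDimensional.proper ℂ K
  filter_upwards [ae_forall_le_norm_apply hbound] with ζ hζ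
  refine ⟨?_, ContinuousLinearMap.isInvertible_of_le_norm_apply (hK.trans hK'.symm) hc hζ⟩
  -- When `K = 0` the boundary value is always `0` and cannot be told from the default, but `φ` is
  -- constant, so convergence is trivial.
  rcases subsingleton_or_nontrivial K with _ | _
  · have hconst : φ = fun _ => boundaryValue Ω φ ζ := funext fun _ => Subsingleton.elim _ _
    exact tendsto_const_nhds.congr fun z => (congrFun hconst z).symm
  · obtain ⟨k, hk⟩ := exists_ne (0 : K)
    have hne : boundaryValue Ω φ ζ ≠ 0 := fun h0 => by
      have hle := hζ k
      rw [h0, zero_apply, norm_zero] at hle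
      exact absurd hle (not_le.2 (mul_pos hc (norm_pos_iff.2 hk)))
    obtain ⟨T, hT⟩ := exists_hasNontangentialLimit_of_boundaryValue_ne_zero hne
    exact hT.tendsto_boundaryValue
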